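/- Let $G$ be a finite connected bipartite multigraph without loops (parallel edges allowed) in which every vertex has even degree, drawn in the plane without crossings: vertices are distinct points, every edge is a simple continuous arc joining its two ends, and the interior of an edge contains no vertex and no point of another edge. A cycle is a closed walk of positive length with no repeated vertex (other than the coinciding first and last one) and no repeated edge, regarded up to starting point and direction; a cycle decomposition of $G$ is a finite family $\mathcal D=\{d_1,\dots,d_k\}$ of cycles of $G$ such that every edge of $G$ belongs to exactly one of them. For a cycle $d$ let $\chi(d)$ be the number of vertices of $G$ enclosed by $d$, i.e. lying off $d$ and in the bounded region of the plane cut out by $d$, and define the sign of a cycle decomposition by $$\operatorname{sgn}(\mathcal D)=\prod_{d\in\mathcal D}(-1)^{\chi(d)+1}.$$ Then all cycle decompositions of $G$ have the same sign: $\operatorname{sgn}(\mathcal D)=\operatorname{sgn}(\mathcal D')$ for any two cycle decompositions $\mathcal D,\mathcal D'$ of $G$. -/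

import Mathlib

universe u v

namespace Graph

variable {α : Type u} {β : Type v}

/-! ### Multigraphs

Mathlib's `Graph α β` is a multigraph with vertex set `V(G) : Set α` and edge set
`E(G) : Set β`; parallel edges are allowed. -/

/-- The number of edges incident to `x` (the degree of `x` in a loopless multigraph). -/
noncomputable def numIncident (G : Graph α β) (x : α) : ℕ := (G.incidenceSet x).ncard

/-- Every vertex has even degree (for loopless multigraphs). -/
def IsEven (G : Graph α β) : Prop := ∀ x ∈ G.vertexSet, Even (G.numIncident x)

/-- `G` has a vertex, and any two vertices are joined by a walk. -/
def IsConnected (G : Graph α β) : Prop :=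
  G.vertexSet.Nonempty ∧
    ∀ x ∈ G.vertexSet, ∀ y ∈ G.vertexSet, Relation.ReflTransGen G.Adj x y

/-- The vertex set is the disjoint union of two sets `X` and `Y` such that every edge has one end
in `X` and the other end in `Y`. -/
def IsBipartite (G : Graph α β) : Prop :=
  ∃ X Y : Set α, Disjoint X Y ∧ X ∪ Y = G.vertexSet ∧
    ∀ e ∈ G.edgeSet, ∃ x ∈ X, ∃ y ∈ Y, G.IsLink e x y

/-- `C` is the edge set of a cycle of `G`: there is a closed walk
`v 0, e 0, v 1, e 1, …, e (k - 1), v k = v 0` with `k ≥ 1` whose vertices `v 0, …, v (k - 1)` are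
distinct, whose edges are distinct, and whose set of edges is `C`.
(For `k = 2` this is a pair of parallel edges; `k = 1` would need a loop.) -/
def IsCycleSet (G : Graph α β) (C : Set β) : Prop :=
  ∃ (k : ℕ) (v : ℕ → α) (e : ℕ → β), 0 < k ∧ v k = v 0 ∧
    Set.InjOn v (Set.Iio k) ∧ Set.InjOn e (Set.Iio k) ∧
    (∀ i < k, G.IsLink (e i) (v i) (v (i + 1))) ∧ C = e '' Set.Iio k

/-- `D` is a cycle decomposition of `G`: a finite family of cycles (given by their edge sets)
such that no edge belongs to two of them and every edge of `G` belongs to one of them. -/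
structure IsCycleDecomposition (G : Graph α β) (D : Finset (Set β)) : Prop where
  isCycleSet : ∀ C ∈ D, G.IsCycleSet C
  disjoint : ∀ C ∈ D, ∀ C' ∈ D, C ≠ C' → Disjoint C C'
  cover : ⋃ C ∈ D, C = G.edgeSet

/-! ### Plane multigraphs -/

/-- A drawing of `G` in the plane `ℂ = ℝ²` without crossings: vertices are distinct points, every
edge is a simple (continuous) arc joining the points of its two ends, and the interior of an
edge contains no vertex and no point of another edge. (This makes sense for loopless `G`.) -/
structure PlaneDrawing (G : Graph α β) where
  /-- the point of a vertex -/
  point : α → ℂ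
  /-- the arc of an edge -/
  arc : β → C(unitInterval, ℂ)
  point_injOn : Set.InjOn point G.vertexSet
  arc_injective : ∀ e ∈ G.edgeSet, Function.Injective (arc e)
  arc_ends : ∀ e x y, G.IsLink e x y →
    (arc e 0 = point x ∧ arc e 1 = point y) ∨ (arc e 0 = point y ∧ arc e 1 = point x)
  arc_ne_point : ∀ e ∈ G.edgeSet, ∀ t : unitInterval, t ≠ 0 → t ≠ 1 →
    ∀ x ∈ G.vertexSet, arc e t ≠ point x
  arc_ne_arc : ∀ e ∈ G.edgeSet, ∀ f ∈ G.edgeSet, e ≠ f →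
    ∀ t : unitInterval, t ≠ 0 → t ≠ 1 → ∀ s : unitInterval, arc e t ≠ arc f s

namespace PlaneDrawing

variable {G : Graph α β} (φ : G.PlaneDrawing)

/-- The set of points of the plane covered by the (closed) edges in `C`; for a cycle `C` this is
a simple closed curve. -/
def trace (C : Set β) : Set ℂ := ⋃ e ∈ C, Set.range (φ.arc e)

/-- The point `z` is enclosed by the edges in `C`: it is not on them and it lies in a bounded
connected component of their complement. -/
def Encloses (C : Set β) (z : ℂ) : Prop :=
  z ∉ φ.trace C ∧ Bornology.IsBounded (connectedComponentIn (φ.trace C)ᶜ z)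

/-- `χ(C)`: the number of vertices of `G` enclosed by `C`. -/
noncomputable def chi (C : Set β) : ℕ := {x ∈ G.vertexSet | φ.Encloses C (φ.point x)}.ncard

/-- The sign `∏_{d ∈ D} (-1)^{χ(d) + 1}` of a family `D` of edge-disjoint cycles. -/
noncomputable def sign (D : Finset (Set β)) : ℤ := ∏ d ∈ D, (-1) ^ (φ.chi d + 1)

end PlaneDrawing

end Graph

/-! The sign is a product of edge weights that do not depend on the decomposition: there is `κ : β →
ℂ` whose product over every cycle `C` is `(-1) ^ (χ(C) + 1)` (`exists_edge_weights`). Since a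
decomposition partitions the edge set, its sign is the product of `κ` over all edges
(`sign_eq_finprod`).

For an edge from `x` to `y`, let `edgeLog` be the total variation of `log (z - w)` along it, summed
over all vertices `w` other than `x` and `y`. With `P x = ∏ (x - w)` over the vertices `w ≠ x`, its
exponential is `-P y / P x`. Hence `exp (edgeLog / 2)`, corrected by square roots of `P` at the two
ends, squares to `-1` and changes sign when the edge is reversed. Around a cycle the corrections
telescope, so the product is the exponential of half the total variation.

Consider a cycle of length `2m`. A vertex off it contributes `exp (π i n)`, with `n` its winding
number, and `n` is odd exactly when the vertex is enclosed (`isBounded_iff_odd`). The vertices on it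
contribute together half the angle sum `(2m - 2) k π i` with `k` odd (`exists_sum_sum_logVar`),
hence `(-1) ^ (m - 1)`. Orienting all edges from `X` to `Y` reverses every second edge of the cycle,
which costs a further `(-1) ^ m`. The total is `(-1) ^ (χ + 1)`.

Neither topological input needs the Jordan curve theorem: parity suffices, and it follows from
lifting arguments. -/

section

open Set Filter Topology Complex

/-! ### Continuous logarithms and their uniqueness. -/

/-- A nonvanishing continuous function on a convex open set has a continuous logarithm. -/
lemma exists_continuousOn_log {E : Type*} [NormedAddCommGroup E] [NormedSpace ℝ E] {S : Set E}
    (hS : Convex ℝ S) (hS' : IsOpen S) (hne : S.Nonempty) {f : E → ℂ} (hf : ContinuousOn f S)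
    (h0 : ∀ x ∈ S, f x ≠ 0) : ∃ L : E → ℂ, ContinuousOn L S ∧ ∀ x ∈ S, exp (L x) = f x := by
  have hsc : IsSimplyConnected S := by
    have := hS.contractibleSpace hne
    exact (inferInstance : SimplyConnectedSpace S)
  obtain ⟨L, hL, hL'⟩ := Complex.exists_continuousOn_eqOn_exp_comp hsc hS' hf
    (by rintro ⟨x, hx, hx'⟩; exact h0 x hx hx')
  exact ⟨L, hL, fun x hx => hL' hx⟩

lemma exists_continuous_log {E : Type*} [NormedAddCommGroup E] [NormedSpace ℝ E] {f : E → ℂ}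
    (hf : Continuous f) (h0 : ∀ x, f x ≠ 0) :
    ∃ L : E → ℂ, Continuous L ∧ ∀ x, exp (L x) = f x := by
  obtain ⟨L, hL, hL'⟩ := exists_continuousOn_log convex_univ isOpen_univ ⟨0, mem_univ _⟩
    hf.continuousOn (fun x _ => h0 x)
  exact ⟨L, continuousOn_univ.1 hL, fun x => hL' x (mem_univ x)⟩

/-- Two continuous logarithms of the same function on a preconnected set differ by a constant. -/
lemma exists_int_of_exp_eq {X : Type*} [TopologicalSpace X] {S : Set X} (hS : IsPreconnected S)
    {L L' : X → ℂ} (hL : ContinuousOn L S) (hL' : ContinuousOn L' S)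
    (h : ∀ x ∈ S, exp (L x) = exp (L' x)) :
    ∃ n : ℤ, ∀ x ∈ S, L x = L' x + n * (2 * Real.pi * I) := by
  choose! n hn using fun x (hx : x ∈ S) => Complex.exp_eq_exp_iff_exists_int.1 (h x hx)
  rcases S.eq_empty_or_nonempty with rfl | ⟨a, ha⟩
  · exact ⟨0, by simp⟩
  have hpi : (2 * Real.pi * I : ℂ) ≠ 0 := Complex.two_pi_I_ne_zero
  have key : ∀ x ∈ S, ((n x : ℤ) : ℝ) = ((L x - L' x) / (2 * Real.pi * I)).re := by
    intro x hx
    have : (L x - L' x) / (2 * Real.pi * I) = ((n x : ℝ) : ℂ) := by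
      rw [hn x hx]; field_simp; push_cast; ring
    rw [this, ofReal_re]
  have hc : ContinuousOn (fun x => ((n x : ℤ) : ℝ)) S := by
    refine ContinuousOn.congr ?_ key
    exact Complex.continuous_re.comp_continuousOn ((hL.sub hL').div_const _)
  have hc' : ContinuousOn n S := by
    -- The integer ambiguity is continuous, hence constant on a preconnected set.
    have := Int.isClosedEmbedding_coe_real.isInducing
    exact this.continuousOn_iff.2 hc
  refine ⟨n a, fun x hx => ?_⟩
  rw [hn x hx]
  have : n x = n a := hS.constant_of_mapsTo (T := univ) (isDiscrete_univ_iff.2 inferInstance) hc' (mapsTo_univ _ _) hx ha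
  rw [this]

/-! ### Winding parity of a simple closed curve. -/

/-- `d - z` has a continuous logarithm with period `p`. -/
def HasPeriodicLog (d : ℝ → ℂ) (p : ℝ) (z : ℂ) : Prop :=
  ∃ L : ℝ → ℂ, Continuous L ∧ Function.Periodic L p ∧ ∀ t, exp (L t) = d t - z

/-- The quotient `(d t - w) / (d t - z)` stays within distance `1` of `1`, so its principal
logarithm is a periodic correction term. -/
lemma HasPeriodicLog.of_norm_lt {d : ℝ → ℂ} {p : ℝ} (hd : Continuous d)
    (hp : Function.Periodic d p) {z w : ℂ} (h : HasPeriodicLog d p z)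
    (hw : ∀ t, ‖w - z‖ < ‖d t - z‖) : HasPeriodicLog d p w := by
  obtain ⟨L, hL, hLp, hLe⟩ := h
  have h0 : ∀ t, d t - z ≠ 0 := fun t h => by
    have := hw t; rw [h, norm_zero] at this; exact absurd this (not_lt.2 (norm_nonneg _))
  have hs : ∀ t, 1 - (w - z) / (d t - z) ∈ slitPlane := by
    intro t
    rw [sub_eq_add_neg]
    refine mem_slitPlane_of_norm_lt_one ?_
    rw [norm_neg, norm_div, div_lt_one (norm_pos_iff.2 (h0 t))]
    exact hw t
  refine ⟨fun t => L t + log (1 - (w - z) / (d t - z)), ?_, ?_, ?_⟩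
  · refine hL.add (Continuous.clog ?_ hs)
    exact continuous_const.sub (continuous_const.div (hd.sub continuous_const) h0)
  · intro t
    simp only [hLp t, hp t]
  · intro t
    have := h0 t
    rw [Complex.exp_add, hLe, Complex.exp_log (slitPlane_ne_zero (hs t))]
    field_simp
    ring

lemma hasPeriodicLog_of_norm_lt {d : ℝ → ℂ} {p : ℝ} (hd : Continuous d)
    (hp : Function.Periodic d p) {w : ℂ} (hw : ∀ t, ‖d t‖ < ‖w‖) : HasPeriodicLog d p w := by
  have h0 : w ≠ 0 := fun h => by
    have := hw 0; rw [h, norm_zero] at this; exact absurd this (not_lt.2 (norm_nonneg _))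
  have hs : ∀ t, 1 - d t / w ∈ slitPlane := by
    intro t
    rw [sub_eq_add_neg]
    refine mem_slitPlane_of_norm_lt_one ?_
    rw [norm_neg, norm_div, div_lt_one (norm_pos_iff.2 h0)]
    exact hw t
  refine ⟨fun t => log (-w) + log (1 - d t / w), ?_, ?_, ?_⟩
  · exact continuous_const.add (Continuous.clog (by fun_prop) hs)
  · intro t
    simp only [hp t]
  · intro t
    rw [Complex.exp_add, Complex.exp_log (neg_ne_zero.2 h0),
      Complex.exp_log (slitPlane_ne_zero (hs t))]
    field_simp
    ring

lemma isCompact_range_of_periodic {d : ℝ → ℂ} {p : ℝ} (hd : Continuous d)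
    (hp : Function.Periodic d p) (h0 : 0 < p) : IsCompact (range d) := by
  rw [← hp.image_Icc h0 0]
  exact isCompact_Icc.image hd

/-- The winding number about a point vanishes if the point lies in an unbounded connected set
missing the curve. -/
lemma hasPeriodicLog_of_unbounded {d : ℝ → ℂ} {p : ℝ} (hd : Continuous d)
    (hp : Function.Periodic d p) (h0 : 0 < p) {K : Set ℂ} (hK : IsPreconnected K)
    (hKd : Disjoint K (range d)) (hKb : ¬ Bornology.IsBounded K) {z : ℂ} (hz : z ∈ K) :
    HasPeriodicLog d p z := by
  have hJ := isCompact_range_of_periodic hd hp h0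
  have hJne : (range d).Nonempty := range_nonempty d
  -- Off the curve, having a periodic logarithm is locally constant; half the distance to the curve
  -- is small enough to compare in both directions.
  have hball : ∀ w ∉ range d, ∃ ε > 0, ∀ w' ∈ Metric.ball w ε,
      w' ∉ range d ∧ (HasPeriodicLog d p w ↔ HasPeriodicLog d p w') := by
    intro w hw
    have hpos : 0 < Metric.infDist w (range d) :=
      (hJ.isClosed.notMem_iff_infDist_pos hJne).1 hw
    have hle : ∀ t, Metric.infDist w (range d) ≤ ‖d t - w‖ := fun t => by
      have := Metric.infDist_le_dist_of_mem (x := w) (mem_range_self (f := d) t)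
      rwa [dist_comm, dist_eq_norm] at this
    refine ⟨_, half_pos hpos, fun w' hw' => ?_⟩
    rw [mem_ball_iff_norm] at hw'
    have h1 : ∀ t, ‖w' - w‖ < ‖d t - w‖ := fun t => by linarith [hle t]
    have h2 : ∀ t, ‖w - w'‖ < ‖d t - w'‖ := fun t => by
      have := norm_sub_le_norm_sub_add_norm_sub (d t) w' w
      rw [norm_sub_rev w w']
      linarith [hle t]
    refine ⟨?_, fun h => h.of_norm_lt hd hp h1, fun h => h.of_norm_lt hd hp h2⟩
    rintro ⟨t, rfl⟩
    exact lt_irrefl _ (h1 t)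
  have hU : IsOpen {w | w ∉ range d ∧ HasPeriodicLog d p w} := by
    rw [Metric.isOpen_iff]
    rintro w ⟨hw, hw'⟩
    obtain ⟨ε, hε, h⟩ := hball w hw
    exact ⟨ε, hε, fun x hx => ⟨(h x hx).1, (h x hx).2.1 hw'⟩⟩
  have hV : IsOpen {w | w ∉ range d ∧ ¬ HasPeriodicLog d p w} := by
    rw [Metric.isOpen_iff]
    rintro w ⟨hw, hw'⟩
    obtain ⟨ε, hε, h⟩ := hball w hw
    exact ⟨ε, hε, fun x hx => ⟨(h x hx).1, fun h' => hw' ((h x hx).2.2 h')⟩⟩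
  obtain ⟨R, hR⟩ := hJ.isBounded.exists_norm_le
  obtain ⟨w, hwK, hwR⟩ : ∃ w ∈ K, R < ‖w‖ := by
    by_contra! h
    exact hKb (isBounded_iff_forall_norm_le.2 ⟨R, h⟩)
  have hsub : K ⊆ {w | w ∉ range d ∧ HasPeriodicLog d p w} := by
    refine hK.subset_left_of_subset_union hU hV ?_ ?_ ⟨w, hwK, ?_, ?_⟩
    · exact Set.disjoint_left.2 fun x hx hx' => hx'.2 hx.2
    · intro x hx
      have := Set.disjoint_left.1 hKd hx
      by_cases h : HasPeriodicLog d p x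
      · exact Or.inl ⟨this, h⟩
      · exact Or.inr ⟨this, h⟩
    · exact Set.disjoint_left.1 hKd hwK
    · exact hasPeriodicLog_of_norm_lt hd hp fun t => (hR _ (mem_range_self t)).trans_lt hwR
  exact (hsub hz).2

/-- If the component of `z` in the complement of a closed curve `d` is bounded, then `d - z` has
no logarithm on the curve. -/
lemma not_hasPeriodicLog_of_bounded {d : ℝ → ℂ} {p : ℝ} (hd : Continuous d)
    (hp : Function.Periodic d p) (h0 : 0 < p) (hinj : ∀ s t, d s = d t → ∃ m : ℤ, t = s + m * p)
    {z : ℂ} (hz : z ∉ range d)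
    (hb : Bornology.IsBounded (connectedComponentIn (range d)ᶜ z)) :
    ¬ HasPeriodicLog d p z := by
  rintro ⟨L, hL, hLp, hLe⟩
  have hJ := isCompact_range_of_periodic hd hp h0
  -- descend the logarithm to the curve
  have hLd : ∀ s t, d s = d t → L s = L t := by
    intro s t h
    obtain ⟨m, rfl⟩ := hinj s t h
    exact (hLp.int_mul m s).symm
  choose τ hτ using fun x : range d => x.2
  let q : Icc (0 : ℝ) p → range d := fun t => ⟨d t, mem_range_self _⟩
  have hq : Continuous q := by fun_prop
  have hqs : Function.Surjective q := by
    rintro ⟨x, hx⟩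
    rw [← hp.image_Icc h0 0, zero_add] at hx
    obtain ⟨t, ht, rfl⟩ := hx
    exact ⟨⟨t, ht⟩, rfl⟩
  have hqq : IsQuotientMap q := hq.isClosedMap.isQuotientMap hq hqs
  have hg : Continuous (fun x : range d => L (τ x)) := by
    rw [hqq.continuous_iff]
    have : (fun x : range d => L (τ x)) ∘ q = fun t : Icc (0 : ℝ) p => L t := by
      ext t
      exact hLd _ _ (hτ (q t))
    rw [this]
    fun_prop
  -- Tietze extension of the logarithm from the compact curve to the plane.
  obtain ⟨g, hgL⟩ := ContinuousMap.exists_restrict_eq hJ.isClosed ⟨_, hg⟩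
  have hge : ∀ x ∈ range d, exp (g x) = x - z := by
    intro x hx
    have : g x = L (τ ⟨x, hx⟩) := congrArg (fun f => f ⟨x, hx⟩) hgL
    rw [this, hLe, hτ ⟨x, hx⟩]
  set U := connectedComponentIn (range d)ᶜ z with hUdef
  have hUo : IsOpen U := hJ.isClosed.isOpen_compl.connectedComponentIn
  -- A frontier point off the curve would have its own open component meeting `U`, hence equal to
  -- `U`.
  have hfr : frontier U ⊆ range d := by
    intro x hx
    by_contra hxd
    have hxc : x ∈ connectedComponentIn (range d)ᶜ x := mem_connectedComponentIn hxd
    have hox : IsOpen (connectedComponentIn (range d)ᶜ x) :=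
      hJ.isClosed.isOpen_compl.connectedComponentIn
    obtain ⟨y, hy, hyU⟩ := mem_closure_iff.1 (frontier_subset_closure hx) _ hox hxc
    have h1 := connectedComponentIn_eq hy
    have h2 := connectedComponentIn_eq hyU
    rw [hUo.frontier_eq] at hx
    exact hx.2 (by rw [hUdef, h2, ← h1]; exact hxc)
  classical
  -- Borsuk's argument: replacing `x - z` inside `U` by `exp (g x)` removes its only zero, so `F`
  -- has a logarithm on the whole plane. Far away `F` is still `x - z`, which winds once around a
  -- large circle.
  let F : ℂ → ℂ := U.piecewise (fun x => exp (g x)) (fun x => x - z)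
  have hF : Continuous F := by
    refine Continuous.piecewise (fun x hx => hge x (hfr hx)) ?_ ?_ <;> fun_prop
  have hzU : z ∈ U := mem_connectedComponentIn hz
  have hF0 : ∀ x, F x ≠ 0 := by
    intro x
    by_cases hx : x ∈ U
    · simp only [F, piecewise_eq_of_mem _ _ _ hx]; exact exp_ne_zero _
    · simp only [F, piecewise_eq_of_notMem _ _ _ hx]
      intro h
      rw [sub_eq_zero] at h
      exact hx (h ▸ hzU)
  obtain ⟨M, hM, hMF⟩ := exists_continuous_log hF hF0
  obtain ⟨R, hR⟩ := hb.exists_norm_le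
  -- The circle of radius `r` about `z` lies outside the ball of radius `R` containing `U`.
  let r : ℝ := |R| + ‖z‖ + 1
  have hr : 0 < r := by positivity
  have hc : ∀ t : ℝ, F (z + r * exp (t * I)) = r * exp (t * I) := by
    intro t
    have : z + r * exp (t * I) ∉ U := by
      intro h
      have h1 := hR _ h
      have h2 : ‖(r : ℂ) * exp (t * I)‖ = r := by
        rw [norm_mul, Complex.norm_exp_ofReal_mul_I, mul_one, norm_real, Real.norm_of_nonneg hr.le]
      have h4 : ‖(r : ℂ) * exp (t * I)‖ ≤ ‖z + r * exp (t * I)‖ + ‖z‖ := by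
        have := norm_sub_le (z + r * exp (t * I)) z
        simpa using this
      have := le_abs_self R
      simp only [r] at h2 h4 
      rw [h2] at h4
      linarith
    simp only [F, piecewise_eq_of_notMem _ _ _ this]
    ring
  obtain ⟨n, hn⟩ := exists_int_of_exp_eq (S := (univ : Set ℝ)) isPreconnected_univ
    (L := fun t : ℝ => M (z + r * exp (t * I))) (L' := fun t : ℝ => Real.log r + t * I)
    (by fun_prop) (by fun_prop) (by
      intro t _
      rw [hMF, hc, Complex.exp_add, ← ofReal_exp, Real.exp_log hr])
  have e0 := hn 0 (mem_univ _)
  have e1 := hn (2 * Real.pi) (mem_univ _)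
  have : exp (((2 * Real.pi : ℝ) : ℂ) * I) = exp (((0 : ℝ) : ℂ) * I) := by
    simp
  rw [this, e0] at e1
  have : (2 * Real.pi * I : ℂ) = 0 := by
    push_cast at e1
    linear_combination -e1
  exact Complex.two_pi_I_ne_zero this

/-- The winding number of a simple closed curve about a point off the curve is odd exactly when the
component of the point in the complement of the curve is bounded. -/
lemma isBounded_iff_odd {d : ℝ → ℂ} {p : ℝ} (hd : Continuous d)
    (hp : Function.Periodic d p) (h0 : 0 < p) (hinj : ∀ s t, d s = d t → ∃ m : ℤ, t = s + m * p)
    {z : ℂ} (hz : z ∉ range d) {L : ℝ → ℂ} (hL : Continuous L) (hLe : ∀ t, exp (L t) = d t - z)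
    {n : ℤ} (hn : ∀ t, L (t + p) = L t + n * (2 * Real.pi * I)) :
    Bornology.IsBounded (connectedComponentIn (range d)ᶜ z) ↔ Odd n := by
  have hpi : (2 * Real.pi * I : ℂ) ≠ 0 := Complex.two_pi_I_ne_zero
  -- a periodic logarithm forces winding number zero
  have hzero : ∀ {e : ℝ → ℂ} {M : ℝ → ℂ} {w : ℂ} {m : ℤ}, Continuous M →
      (∀ t, exp (M t) = e t - w) → (∀ t, M (t + p) = M t + m * (2 * Real.pi * I)) →
      HasPeriodicLog e p w → m = 0 := by
    rintro e M w m hM hMe hm ⟨M', hM', hM'p, hM'e⟩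
    obtain ⟨j, hj⟩ := exists_int_of_exp_eq (S := (univ : Set ℝ)) isPreconnected_univ
      hM.continuousOn hM'.continuousOn (fun t _ => by rw [hMe, hM'e])
    have h1 := hj 0 (mem_univ _)
    have h2 := hj (0 + p) (mem_univ _)
    rw [hM'p, hm, h1] at h2
    have : (m : ℂ) * (2 * Real.pi * I) = 0 := by linear_combination h2
    exact_mod_cast (mul_eq_zero.1 this).resolve_right hpi
  constructor
  · intro hb
    by_contra hodd
    rw [Int.not_odd_iff_even] at hodd
    obtain ⟨m, rfl⟩ := hodd
    -- a square root of `d - z`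
    let s : ℝ → ℂ := fun t => exp (L t / 2)
    have hs : Continuous s := by fun_prop
    have hs0 : ∀ t, s t ≠ 0 := fun t => exp_ne_zero _
    have hss : ∀ t, s t * s t = d t - z := fun t => by
      rw [← hLe, ← Complex.exp_add]; congr 1; ring
    have hhalf : ∀ t, L (t + p) / 2 = L t / 2 + m * (2 * Real.pi * I) := fun t => by
      rw [hn]; push_cast; ring
    have hsp : Function.Periodic s p := fun t => by
      simp only [s, hhalf, Complex.exp_periodic.int_mul m (L t / 2)]
    -- If `s t = -s t'`, squaring gives `d t = d t'`, so the parameters differ by a multiple of the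
    -- period; then `s t = s t'`, contradicting `s ≠ 0`.
    have hneg : ∀ t t', s t ≠ - s t' := by
      intro t t' h
      have : d t = d t' := by
        have h1 := hss t
        rw [h, neg_mul_neg, hss t'] at h1
        linear_combination -h1
      obtain ⟨k, rfl⟩ := hinj _ _ this
      rw [hsp.int_mul k t] at h
      exact hs0 t (self_eq_neg.1 h)
    have hc : IsCompact (range s) := isCompact_range_of_periodic hs hsp h0
    obtain ⟨P, ⟨tP, rfl⟩, hP⟩ := hc.exists_isMaxOn (range_nonempty s) continuous_norm.continuousOn
    obtain ⟨Q, ⟨tQ, rfl⟩, hQ⟩ := hc.exists_isMinOn (range_nonempty s) continuous_norm.continuousOn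
    have hmax : ∀ t, ‖s t‖ ≤ ‖s tP‖ := fun t => hP (mem_range_self t)
    have hmin : ∀ t, ‖s tQ‖ ≤ ‖s t‖ := fun t => hQ (mem_range_self t)
    -- The curve `-s` misses `s`. Joining `0` to a point of `-s` nearest to the origin, and a
    -- farthest point of `-s` to infinity, gives a connected unbounded set through `0` that still
    -- misses `s`. So `s` does not wind around `0`.
    let A : Set ℂ := (fun r : ℝ => -(r * s tQ)) '' Icc 0 1
    let B : Set ℂ := range fun t => - s t
    let C : Set ℂ := (fun r : ℝ => -(r * s tP)) '' Ici 1
    have hA : IsPreconnected A := isPreconnected_Icc.image _ (by fun_prop)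
    have hB : IsPreconnected B := isPreconnected_range (by fun_prop)
    have hC : IsPreconnected C := isPreconnected_Ici.image _ (by fun_prop)
    have hAB : IsPreconnected (A ∪ B) :=
      IsPreconnected.union (-s tQ) ⟨1, by simp, by simp⟩ ⟨tQ, rfl⟩ hA hB
    have hABC : IsPreconnected (A ∪ B ∪ C) :=
      IsPreconnected.union (-s tP) (Or.inr ⟨tP, rfl⟩) ⟨1, by simp, by simp⟩ hAB hC
    have hdisj : Disjoint (A ∪ B ∪ C) (range s) := by
      rw [Set.disjoint_left]
      rintro x hx ⟨t, rfl⟩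
      rcases hx with (⟨r, hr, h⟩ | ⟨t', h⟩) | ⟨r, hr, h⟩
      · have h1 := congrArg norm h
        simp only [norm_neg, norm_mul, norm_real, Real.norm_of_nonneg hr.1] at h1
        have h2 := hmin t
        have h3 : 0 < ‖s tQ‖ := norm_pos_iff.2 (hs0 _)
        have : r = 1 := le_antisymm hr.2 (by nlinarith)
        subst this
        simp only [ofReal_one, one_mul] at h
        exact hneg _ _ h.symm
      · exact hneg _ _ h.symm
      · have h1 := congrArg norm h
        have hr' : (1 : ℝ) ≤ r := hr
        simp only [norm_neg, norm_mul, norm_real, Real.norm_of_nonneg (zero_le_one.trans hr')] at h1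
        have h2 := hmax t
        have h3 : 0 < ‖s tP‖ := norm_pos_iff.2 (hs0 _)
        have : r = 1 := le_antisymm (by nlinarith) hr'
        subst this
        simp only [ofReal_one, one_mul] at h
        exact hneg _ _ h.symm
    have hunb : ¬ Bornology.IsBounded (A ∪ B ∪ C) := by
      intro hb
      obtain ⟨R, hR⟩ := hb.exists_norm_le
      have h3 : 0 < ‖s tP‖ := norm_pos_iff.2 (hs0 _)
      let r := 1 + |R| / ‖s tP‖
      have hr : 1 ≤ r := by simp only [r]; linarith [show 0 ≤ |R| / ‖s tP‖ by positivity]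
      have := hR (-(r * s tP)) (Or.inr ⟨r, hr, rfl⟩)
      rw [norm_neg, norm_mul, norm_real, Real.norm_of_nonneg (zero_le_one.trans hr)] at this
      simp only [r, add_mul, div_mul_cancel₀ _ h3.ne'] at this
      linarith [le_abs_self R]
    have hlog : HasPeriodicLog s p 0 :=
      hasPeriodicLog_of_unbounded hs hsp h0 hABC hdisj hunb
        (Or.inl (Or.inl ⟨0, by simp, by simp⟩))
    have hm : m = 0 := hzero (M := fun t => L t / 2) (by fun_prop) (fun t => by simp [s]) hhalf hlog
    subst hm
    exact not_hasPeriodicLog_of_bounded hd hp h0 hinj hz hb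
      ⟨L, hL, fun t => by rw [hn]; simp, hLe⟩
  · intro hodd
    by_contra hb
    have hlog := hasPeriodicLog_of_unbounded hd hp h0 isPreconnected_connectedComponentIn
      (Set.disjoint_left.2 fun x hx => connectedComponentIn_subset _ _ hx) hb
      (mem_connectedComponentIn hz)
    have : n = 0 := hzero hL hLe hn hlog
    subst this
    exact absurd hodd (by decide)

/-! ### The secant map and the angle sum. -/

/-- A logarithm of the secant map `(s, t) ↦ d t - d s` of a simple closed curve, together with its
monodromy under exchanging the two points. -/
lemma exists_secant_log {d : ℝ → ℂ} {p : ℝ} (hd : Continuous d)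
    (hp : Function.Periodic d p) (h0 : 0 < p)
    (hinj : ∀ s t, d s = d t → ∃ m : ℤ, t = s + m * p) :
    ∃ (Φ : ℝ × ℝ → ℂ) (k : ℤ), Odd k ∧
      ContinuousOn Φ {x | x.1 < x.2 ∧ x.2 < x.1 + p} ∧
      (∀ s t, s < t → t < s + p → exp (Φ (s, t)) = d t - d s) ∧
      ∀ s t, s < t → t < s + p → Φ (t, s + p) = Φ (s, t) + k * (Real.pi * I) := by
  set S : Set (ℝ × ℝ) := {x | x.1 < x.2 ∧ x.2 < x.1 + p} with hS
  have hconv : Convex ℝ S := by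
    rintro ⟨a, b⟩ ⟨h1, h2⟩ ⟨a', b'⟩ ⟨h1', h2'⟩ u v hu hv huv
    simp only [hS, mem_ofPred_eq, Prod.smul_mk, Prod.mk_add_mk, smul_eq_mul] at *
    obtain rfl : v = 1 - u := by linarith
    constructor
    · rcases hu.eq_or_lt with rfl | hu
      · nlinarith
      · nlinarith
    · rcases hu.eq_or_lt with rfl | hu
      · nlinarith
      · nlinarith
  have hopen : IsOpen S :=
    (isOpen_lt continuous_fst continuous_snd).inter
      (isOpen_lt continuous_snd (continuous_fst.add continuous_const))
  have hne : S.Nonempty := ⟨(0, p / 2), by simp only [hS, mem_ofPred_eq]; constructor <;> linarith⟩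
  obtain ⟨Φ, hΦ, hΦe⟩ := exists_continuousOn_log hconv hopen hne (f := fun x => d x.2 - d x.1)
    (by fun_prop) (by
      rintro ⟨s, t⟩ ⟨h1, h2⟩ h
      simp only at h1 h2 h
      obtain ⟨m, rfl⟩ := hinj s t (sub_eq_zero.1 h).symm
      have hm0 : (0 : ℝ) < m := by by_contra! hm; nlinarith
      have hm1 : (m : ℝ) < 1 := by by_contra! hm; nlinarith
      have hm0' : 0 < m := by exact_mod_cast hm0
      have hm1' : m < 1 := by exact_mod_cast hm1
      omega)
  -- Exchanging the two points negates the secant, which accounts for the shift `π i` and makes the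
  -- total shift an odd multiple of it.
  obtain ⟨n, hn⟩ := exists_int_of_exp_eq hconv.isPreconnected
    (L := fun x => Φ (x.2, x.1 + p)) (L' := fun x => Φ x + Real.pi * I)
    (hΦ.comp (by fun_prop) (by
      rintro ⟨s, t⟩ ⟨h1, h2⟩; simp only [hS, mem_ofPred_eq] at *; constructor <;> linarith))
    (hΦ.add continuousOn_const) (by
      rintro ⟨s, t⟩ ⟨h1, h2⟩
      simp only at h1 h2 ⊢
      rw [Complex.exp_add, Complex.exp_pi_mul_I, hΦe (s, t) ⟨h1, h2⟩,
        hΦe (t, s + p) (by constructor <;> simp only <;> linarith)]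
      simp only [hp s]
      ring)
  refine ⟨Φ, 2 * n + 1, ⟨n, rfl⟩, hΦ, fun s t h1 h2 => hΦe _ ⟨h1, h2⟩, fun s t h1 h2 => ?_⟩
  have := hn (s, t) ⟨h1, h2⟩
  simp only at this
  rw [this]
  push_cast
  ring

open Classical in
/-- The increment over `[0, 1]` of a continuous logarithm of `f` (zero if there is none). -/
noncomputable def logVar (f : ℝ → ℂ) : ℂ :=
  if h : ∃ L : ℝ → ℂ, ContinuousOn L (Icc 0 1) ∧ ∀ t ∈ Icc (0 : ℝ) 1, exp (L t) = f t then
    h.choose 1 - h.choose 0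
  else 0

/-- Any logarithm may be used, since two of them differ by a constant on `[0, 1]`. -/
lemma logVar_eq {f L : ℝ → ℂ} (hL : ContinuousOn L (Icc 0 1))
    (h : ∀ t ∈ Icc (0 : ℝ) 1, exp (L t) = f t) : logVar f = L 1 - L 0 := by
  have hex : ∃ L : ℝ → ℂ, ContinuousOn L (Icc 0 1) ∧ ∀ t ∈ Icc (0 : ℝ) 1, exp (L t) = f t :=
    ⟨L, hL, h⟩
  rw [logVar, dif_pos hex]
  obtain ⟨h1, h2⟩ := hex.choose_spec
  obtain ⟨n, hn⟩ := exists_int_of_exp_eq isPreconnected_Icc h1 hL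
    (fun t ht => by rw [h t ht, h2 t ht])
  rw [hn 1 (by simp), hn 0 (by simp)]
  ring

lemma exp_logVar {f : ℝ → ℂ} (hf : Continuous f) (h0 : ∀ t, f t ≠ 0) :
    exp (logVar f) = f 1 / f 0 := by
  obtain ⟨L, hL, h⟩ := exists_continuous_log hf h0
  rw [logVar_eq hL.continuousOn (fun t _ => h t), Complex.exp_sub, h, h]

lemma logVar_reverse {f : ℝ → ℂ} (hf : Continuous f) (h0 : ∀ t, f t ≠ 0) :
    logVar (fun t => f (1 - t)) = - logVar f := by
  obtain ⟨L, hL, h⟩ := exists_continuous_log hf h0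
  rw [logVar_eq hL.continuousOn (fun t _ => h t),
    logVar_eq (L := fun t => L (1 - t)) (by fun_prop) (fun t _ => h _)]
  simp

lemma sum_range_add_of_periodic {M : Type*} [AddCommMonoid M] {f : ℕ → M} {n : ℕ}
    (hf : ∀ i, f (i + n) = f i) (j : ℕ) :
    ∑ i ∈ Finset.range n, f (j + i) = ∑ i ∈ Finset.range n, f i := by
  induction j with
  | zero => simp
  | succ j ih =>
    rw [← ih]
    cases n with
    | zero => simp
    | succ n =>
      rw [Finset.sum_range_succ, Finset.sum_range_succ' (fun i => f (j + i)), add_zero]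
      congr 1
      · exact Finset.sum_congr rfl fun i _ => by congr 1; omega
      · rw [← hf j]; congr 1; omega

lemma natCast_eq_of_periodic {d : ℝ → ℂ} {ℓ : ℕ}
    (hinj : ∀ s t, d s = d t → ∃ m : ℤ, t = s + m * ℓ) {i j : ℕ} (h : d i = d j) :
    (ℓ : ℤ) ∣ j - i := by
  obtain ⟨m, hm⟩ := hinj _ _ h
  refine ⟨m, ?_⟩
  have : (j : ℤ) = i + m * ℓ := by exact_mod_cast hm
  rw [this]; ring

/-- The total variation of the argument along a simple closed curve seen from a point off it. -/
lemma exists_sum_logVar_of_notMem {d : ℝ → ℂ} {ℓ : ℕ} (hd : Continuous d)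
    (hp : Function.Periodic d ℓ) (h0 : 0 < ℓ)
    (hinj : ∀ s t, d s = d t → ∃ m : ℤ, t = s + m * ℓ) {z : ℂ} (hz : z ∉ range d) :
    ∃ n : ℤ, ∑ i ∈ Finset.range ℓ, logVar (fun t => d (i + t) - z) = n * (2 * Real.pi * I) ∧
      (Bornology.IsBounded (connectedComponentIn (range d)ᶜ z) ↔ Odd n) := by
  obtain ⟨L, hL, hLe⟩ := exists_continuous_log (f := fun t => d t - z) (by fun_prop)
    (fun t h => hz ⟨t, sub_eq_zero.1 h⟩)
  obtain ⟨n, hn⟩ := exists_int_of_exp_eq (S := (univ : Set ℝ)) isPreconnected_univ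
    (L := fun t => L (t + ℓ)) (L' := L) (by fun_prop) hL.continuousOn
    (fun t _ => by rw [hLe, hLe, hp t])
  refine ⟨n, ?_, isBounded_iff_odd hd hp (by exact_mod_cast h0) hinj hz hL hLe
    (fun t => hn t (mem_univ t))⟩
  have : ∀ i : ℕ, logVar (fun t => d (i + t) - z) = L ((i + 1 : ℕ) : ℝ) - L (i : ℝ) := by
    intro i
    rw [logVar_eq (L := fun t => L (i + t)) (by fun_prop) (fun t _ => hLe _)]
    simp
  simp only [this]
  rw [Finset.sum_range_sub (fun i : ℕ => L (i : ℝ))]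
  have := hn 0 (mem_univ _)
  simp only [zero_add] at this
  rw [this]
  simp

open Classical in
/-- The angle sum of a simple closed curve with `ℓ` corners: the sum over all corners of the total
variation of the argument, seen from that corner, along the sides not incident with it. -/
lemma exists_sum_sum_logVar {d : ℝ → ℂ} {ℓ : ℕ} (hd : Continuous d)
    (hp : Function.Periodic d ℓ) (h0 : 2 ≤ ℓ)
    (hinj : ∀ s t, d s = d t → ∃ m : ℤ, t = s + m * ℓ) :
    ∃ k : ℤ, Odd k ∧
      ∑ j ∈ Finset.range ℓ, ∑ i ∈ Finset.range ℓ,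
        (if d j = d i ∨ d j = d ((i + 1 : ℕ) : ℝ) then 0 else logVar (fun t => d (i + t) - d j)) =
      (ℓ - 2) * (k * (Real.pi * I)) := by
  obtain ⟨Φ, k, hk, hΦ, hΦe, hΦk⟩ := exists_secant_log hd hp
    (by exact_mod_cast (by omega : 0 < ℓ)) hinj
  refine ⟨k, hk, ?_⟩
  obtain ⟨m, rfl⟩ := Nat.exists_eq_add_of_le' h0
  set p : ℝ := ((m + 2 : ℕ) : ℝ) with hpdef
  have hp' : p = m + 2 := by simp [hpdef]
  have hinner : ∀ j : ℕ, ∑ i ∈ Finset.range (m + 2),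
      (if d j = d i ∨ d j = d ((i + 1 : ℕ) : ℝ) then 0 else logVar (fun t => d (i + t) - d j)) =
      Φ (j, j + m + 1) - Φ (j, j + 1) := by
    intro j
    set T : ℕ → ℂ := fun i => if d j = d i ∨ d j = d ((i + 1 : ℕ) : ℝ) then 0 else
      logVar (fun t => d (i + t) - d j) with hT
    have hTp : ∀ i, T (i + (m + 2)) = T i := by
      intro i
      have h1 : ∀ t : ℝ, d (((i + (m + 2) : ℕ) : ℝ) + t) = d (i + t) := fun t => by
        rw [← hp (i + t), hp']; congr 1; push_cast; ring
      have h2 : d ((i + (m + 2) : ℕ) : ℝ) = d i := by simpa using h1 0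
      have h3 : d ((i + (m + 2) + 1 : ℕ) : ℝ) = d ((i + 1 : ℕ) : ℝ) := by
        have := h1 1
        push_cast at this ⊢
        exact this
      simp only [hT, h1, h2, h3]
    change ∑ i ∈ Finset.range (m + 2), T i = _
    -- Started at side `j`, the sum has the two sides incident with corner `j` as its first and last
    -- terms; both vanish, and the rest telescopes.
    rw [← sum_range_add_of_periodic hTp j, Finset.sum_range_succ, Finset.sum_range_succ']
    have hfirst : T (j + 0) = 0 := by simp [hT]
    have hlast : T (j + (m + 1)) = 0 := by
      have : d ((j + (m + 1) + 1 : ℕ) : ℝ) = d j := by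
        rw [← hp j, hp']; congr 1; push_cast; ring
      simp only [hT, this, or_true, if_true]
    rw [hfirst, hlast, add_zero, add_zero]
    have hmid : ∀ i ∈ Finset.range m, T (j + (i + 1)) =
        Φ (j, j + 1 + ((i + 1 : ℕ) : ℝ)) - Φ (j, j + 1 + ((i : ℕ) : ℝ)) := by
      intro i hi
      have him : (i : ℝ) + 1 ≤ m := by exact_mod_cast Finset.mem_range.1 hi
      have him' := Finset.mem_range.1 hi
      have hi0 : (0 : ℝ) ≤ i := Nat.cast_nonneg i
      have hc : ¬ (d j = d ((j + (i + 1) : ℕ) : ℝ) ∨ d j = d ((j + (i + 1) + 1 : ℕ) : ℝ)) := by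
        rintro (h | h)
        · have := Int.le_of_dvd (by push_cast; omega) (natCast_eq_of_periodic hinj h)
          push_cast at this
          omega
        · have := Int.le_of_dvd (by push_cast; omega) (natCast_eq_of_periodic hinj h)
          push_cast at this
          omega
      simp only [hT, if_neg hc]
      rw [logVar_eq (L := fun t => Φ (j, j + 1 + (i : ℝ) + t))]
      · simp only [add_zero]
        congr 3
        push_cast
        ring
      · refine hΦ.comp (by fun_prop) ?_
        rintro t ⟨ht0, ht1⟩
        simp only [mem_ofPred_eq]
        constructor <;> linarith
      · rintro t ⟨ht0, ht1⟩
        rw [hΦe _ _ (by linarith) (by linarith)]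
        congr 2
        push_cast
        ring
    rw [Finset.sum_congr rfl hmid, Finset.sum_range_sub (fun i : ℕ => Φ (j, j + 1 + (i : ℝ)))]
    simp only [Nat.cast_zero, add_zero]
    congr 3
    ring
  rw [Finset.sum_congr rfl fun j _ => hinner j]
  -- As `j + m + 1 = (j - 1) + p`, one exchange of points brings the far end back to `Φ (j - 1, j)`,
  -- and the sum over `j` telescopes.
  have hj : ∀ j : ℕ, Φ ((j : ℝ), (j : ℝ) + m + 1) - Φ ((j : ℝ), (j : ℝ) + 1) =
      (Φ ((j : ℝ) - 1, (j : ℝ)) - Φ (((j + 1 : ℕ) : ℝ) - 1, ((j + 1 : ℕ) : ℝ))) +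
        k * (Real.pi * I) := by
    intro j
    have hm0 : (0 : ℝ) ≤ m := Nat.cast_nonneg m
    have := hΦk ((j : ℝ) - 1) j (by linarith) (by linarith)
    rw [show (j : ℝ) - 1 + p = j + m + 1 by rw [hp']; ring] at this
    rw [this]
    push_cast
    rw [add_sub_cancel_right]
    ring
  rw [Finset.sum_congr rfl fun j _ => hj j, Finset.sum_add_distrib,
    Finset.sum_range_sub' (fun j : ℕ => Φ ((j : ℝ) - 1, (j : ℝ)))]
  have hm0 : (0 : ℝ) ≤ m := Nat.cast_nonneg m
  -- Going once around the curve is two exchanges, whence the `-2` in `ℓ - 2`.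
  have h1 := hΦk (-1) 0 (by linarith) (by linarith)
  have h2 := hΦk 0 (-1 + p) (by linarith) (by linarith)
  rw [h1] at h2
  have e1 : ((m + 2 : ℕ) : ℝ) - 1 = -1 + p := by rw [hp']; push_cast; ring
  have e2 : ((m + 2 : ℕ) : ℝ) = 0 + p := by rw [hp']; push_cast; ring
  rw [e1, e2, h2]
  simp only [Nat.cast_zero, zero_sub, Finset.sum_const, Finset.card_range, nsmul_eq_mul]
  push_cast
  ring

lemma logVar_congr {f g : ℝ → ℂ} (h : ∀ t ∈ Icc (0 : ℝ) 1, f t = g t) : logVar f = logVar g := by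
  by_cases hex : ∃ L : ℝ → ℂ, ContinuousOn L (Icc 0 1) ∧ ∀ t ∈ Icc (0 : ℝ) 1, exp (L t) = f t
  · obtain ⟨L, hL, hLe⟩ := hex
    rw [logVar_eq hL hLe, logVar_eq hL fun t ht => (hLe t ht).trans (h t ht)]
  · have hex' : ¬ ∃ L : ℝ → ℂ, ContinuousOn L (Icc 0 1) ∧
        ∀ t ∈ Icc (0 : ℝ) 1, exp (L t) = g t := by
      rintro ⟨L, hL, hLe⟩
      exact hex ⟨L, hL, fun t ht => (hLe t ht).trans (h t ht).symm⟩
    rw [logVar, logVar, dif_neg hex, dif_neg hex']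

lemma continuous_of_continuousOn_Icc_int {f : ℝ → ℂ}
    (h : ∀ n : ℤ, ContinuousOn f (Icc (n : ℝ) (n + 1))) : Continuous f := by
  rw [continuous_iff_continuousAt]
  intro t
  -- Two adjacent intervals are needed for a neighbourhood of `t` when `t` is an integer.
  have h1 := (h (⌊t⌋ - 1)).union_of_isClosed (h ⌊t⌋) isClosed_Icc isClosed_Icc
  push_cast at h1
  rw [sub_add_cancel, Icc_union_Icc_eq_Icc (by linarith) (by linarith)] at h1
  exact h1.continuousAt (Icc_mem_nhds (by linarith [Int.floor_le t]) (Int.lt_floor_add_one t))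

/-! ### Cycles as periodic simple closed curves. -/

namespace Graph

variable {α : Type u} {β : Type v} {G : Graph α β}

/-- A cycle can be parametrised periodically by the integers. -/
lemma IsCycleSet.exists_periodic {C : Set β} (h : G.IsCycleSet C) :
    ∃ (k : ℕ) (v : ℤ → α) (e : ℤ → β), 0 < k ∧ (∀ i, G.IsLink (e i) (v i) (v (i + 1))) ∧
      (∀ i j, v i = v j ↔ (k : ℤ) ∣ j - i) ∧ (∀ i j, e i = e j ↔ (k : ℤ) ∣ j - i) ∧
      C = range e := by
  obtain ⟨k, v, e, hk, hvk, hv, he, hl, rfl⟩ := h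
  have hk' : (0 : ℤ) < k := by exact_mod_cast hk
  have hlt : ∀ i : ℤ, (i % k).toNat ∈ Iio k := fun i => by
    have := Int.emod_nonneg i hk'.ne'
    have := Int.emod_lt_of_pos i hk'
    simp only [mem_Iio]
    omega
  have hiff : ∀ i j : ℤ, (i % k).toNat = (j % k).toNat ↔ (k : ℤ) ∣ j - i := fun i j => by
    have := Int.emod_nonneg i hk'.ne'
    have := Int.emod_nonneg j hk'.ne'
    rw [← Int.modEq_iff_dvd, Int.ModEq]
    omega
  refine ⟨k, fun i => v (i % k).toNat, fun i => e (i % k).toNat, hk, fun i => ?_, fun i j => ?_,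
    fun i j => ?_, ?_⟩
  · have h1 := hl _ (hlt i)
    convert h1 using 1
    change v ((i + 1) % (k : ℤ)).toNat = _
    have h2 := hlt i
    have h3 := Int.emod_nonneg i hk'.ne'
    simp only [mem_Iio] at h2
    rcases (Nat.succ_le_of_lt h2).eq_or_lt with h4 | h4
    · have : (i + 1) % (k : ℤ) = 0 := by
        rw [← Int.emod_add_emod, show i % (k : ℤ) + 1 = k by omega, Int.emod_self]
      rw [this, show (i % (k : ℤ)).toNat + 1 = k from h4, hvk]
      rfl
    · have : (i + 1) % (k : ℤ) = i % k + 1 := by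
        rw [← Int.emod_add_emod, Int.emod_eq_of_lt (by omega) (by omega)]
      rw [this]
      congr 1
      omega
  · rw [hv.eq_iff (hlt i) (hlt j), hiff]
  · rw [he.eq_iff (hlt i) (hlt j), hiff]
  · ext x
    constructor
    · rintro ⟨i, hi, rfl⟩
      refine ⟨i, ?_⟩
      simp only
      rw [Int.emod_eq_of_lt (by omega) (by exact_mod_cast hi)]
      rfl
    · rintro ⟨i, rfl⟩
      exact ⟨_, hlt i, rfl⟩

namespace PlaneDrawing

variable (φ : G.PlaneDrawing)

open Classical in
/-- The arc of `e`, extended constantly to the whole line and traversed starting at `x`. -/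
noncomputable def arcFrom (e : β) (x : α) : ℝ → ℂ :=
  if φ.arc e 0 = φ.point x then fun t => φ.arc e (projIcc 0 1 zero_le_one t)
  else fun t => φ.arc e (projIcc 0 1 zero_le_one (1 - t))

lemma continuous_arcFrom (e : β) (x : α) : Continuous (φ.arcFrom e x) := by
  unfold arcFrom
  split_ifs
  · exact (φ.arc e).continuous.comp continuous_projIcc
  · exact (φ.arc e).continuous.comp (continuous_projIcc.comp (by fun_prop))

section Link

variable {e : β} {x y : α}

lemma point_ne [G.Loopless] (h : G.IsLink e x y) : φ.point x ≠ φ.point y := fun hxy =>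
  h.ne (φ.point_injOn h.left_mem h.right_mem hxy)

lemma arcFrom_zero (h : G.IsLink e x y) : φ.arcFrom e x 0 = φ.point x := by
  unfold arcFrom
  split_ifs with h0
  · simpa using h0
  · rcases φ.arc_ends e x y h with h1 | h1
    · exact absurd h1.1 h0
    · simpa using h1.2

lemma arcFrom_symm [G.Loopless] (h : G.IsLink e x y) (t : ℝ) :
    φ.arcFrom e y t = φ.arcFrom e x (1 - t) := by
  have hne := φ.point_ne h
  unfold arcFrom
  rcases φ.arc_ends e x y h with h1 | h1
  · rw [h1.1, if_neg hne, if_pos rfl]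
  · rw [h1.1, if_pos rfl, if_neg hne.symm]
    simp

lemma arcFrom_one [G.Loopless] (h : G.IsLink e x y) : φ.arcFrom e x 1 = φ.point y := by
  have := φ.arcFrom_symm h 0
  rw [φ.arcFrom_zero h.symm, sub_zero] at this
  exact this.symm

lemma exists_arcFrom_eq (e : β) (x : α) (t : ℝ) : ∃ s : unitInterval,
    φ.arcFrom e x t = φ.arc e s ∧ (0 < t → t < 1 → s ≠ 0 ∧ s ≠ 1) := by
  unfold arcFrom
  split_ifs
  · refine ⟨_, rfl, fun h0 h1 => ?_⟩
    rw [projIcc_of_mem _ ⟨h0.le, h1.le⟩]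
    simp only [ne_eq, Subtype.ext_iff, Icc.coe_zero, Icc.coe_one]
    exact ⟨h0.ne', h1.ne⟩
  · refine ⟨_, rfl, fun h0 h1 => ?_⟩
    rw [projIcc_of_mem _ ⟨by linarith, by linarith⟩]
    simp only [ne_eq, Subtype.ext_iff, Icc.coe_zero, Icc.coe_one]
    constructor <;> intro <;> linarith

lemma injOn_arcFrom (he : e ∈ G.edgeSet) (x : α) : InjOn (φ.arcFrom e x) (Icc 0 1) := by
  intro s hs t ht hst
  unfold arcFrom at hst
  split_ifs at hst
  · have := φ.arc_injective e he hst
    rw [projIcc_of_mem _ hs, projIcc_of_mem _ ht] at this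
    simpa using this
  · have := φ.arc_injective e he hst
    rw [projIcc_of_mem _ ⟨by linarith [hs.2], by linarith [hs.1]⟩,
      projIcc_of_mem _ ⟨by linarith [ht.2], by linarith [ht.1]⟩] at this
    have h' : 1 - s = 1 - t := congrArg Subtype.val this
    linarith

lemma exists_arcFrom_eq_arc (e : β) (x : α) (s : unitInterval) :
    ∃ t ∈ Icc (0 : ℝ) 1, φ.arcFrom e x t = φ.arc e s := by
  unfold arcFrom
  split_ifs
  · exact ⟨s, s.2, by simp⟩
  · exact ⟨1 - s, ⟨by linarith [s.2.2], by linarith [s.2.1]⟩, by simp⟩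

lemma arcFrom_ne_point (he : e ∈ G.edgeSet) {w : α} (hw : w ∈ G.vertexSet) {t : ℝ} (h0 : 0 < t)
    (h1 : t < 1) : φ.arcFrom e x t ≠ φ.point w := by
  obtain ⟨s, hs, hs'⟩ := φ.exists_arcFrom_eq e x t
  rw [hs]
  exact φ.arc_ne_point e he s (hs' h0 h1).1 (hs' h0 h1).2 w hw

lemma arcFrom_eq_point [G.Loopless] (h : G.IsLink e x y) {w : α} (hw : w ∈ G.vertexSet) {t : ℝ}
    (ht : t ∈ Icc (0 : ℝ) 1) (hwt : φ.arcFrom e x t = φ.point w) : w = x ∨ w = y := by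
  rcases ht.1.eq_or_lt with rfl | h0
  · rw [φ.arcFrom_zero h] at hwt
    exact Or.inl (φ.point_injOn h.left_mem hw hwt).symm
  rcases ht.2.eq_or_lt with rfl | h1
  · rw [φ.arcFrom_one h] at hwt
    exact Or.inr (φ.point_injOn h.right_mem hw hwt).symm
  · exact absurd hwt (φ.arcFrom_ne_point h.edge_mem hw h0 h1)

lemma arcFrom_ne_point' [G.Loopless] (h : G.IsLink e x y) {w : α} (hw : w ∈ G.vertexSet)
    (hwx : w ≠ x) (hwy : w ≠ y) (t : ℝ) : φ.arcFrom e x t ≠ φ.point w := by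
  intro hwt
  obtain ⟨s, hs, -⟩ := φ.exists_arcFrom_eq e x t
  obtain ⟨t', ht', h'⟩ := φ.exists_arcFrom_eq_arc e x s
  rcases φ.arcFrom_eq_point h hw ht' (h'.trans (hs.symm.trans hwt)) with h | h
  · exact hwx h
  · exact hwy h

end Link

/-- The closed curve running through a periodic walk, at unit time per edge. -/
noncomputable def walkCurve (v : ℤ → α) (e : ℤ → β) (t : ℝ) : ℂ :=
  φ.arcFrom (e ⌊t⌋) (v ⌊t⌋) (Int.fract t)

section Walk

variable {v : ℤ → α} {e : ℤ → β}

lemma walkCurve_intCast (hl : ∀ i, G.IsLink (e i) (v i) (v (i + 1))) (i : ℤ) :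
    φ.walkCurve v e i = φ.point (v i) := by
  simp [walkCurve, φ.arcFrom_zero (hl i)]

lemma walkCurve_add [G.Loopless] (hl : ∀ i, G.IsLink (e i) (v i) (v (i + 1))) (i : ℤ) {t : ℝ}
    (ht : t ∈ Icc (0 : ℝ) 1) : φ.walkCurve v e (i + t) = φ.arcFrom (e i) (v i) t := by
  rcases ht.2.eq_or_lt with rfl | h1
  · have := φ.walkCurve_intCast hl (i + 1)
    push_cast at this
    rw [this, φ.arcFrom_one (hl i)]
  · have hf : ⌊(i : ℝ) + t⌋ = i := by
      rw [Int.floor_eq_iff]; constructor <;> linarith [ht.1]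
    rw [walkCurve, hf, Int.fract, hf]
    congr 1
    ring

lemma continuous_walkCurve [G.Loopless] (hl : ∀ i, G.IsLink (e i) (v i) (v (i + 1))) :
    Continuous (φ.walkCurve v e) := by
  refine continuous_of_continuousOn_Icc_int fun n => ?_
  have : ContinuousOn (fun t : ℝ => φ.arcFrom (e n) (v n) (t - n)) (Icc (n : ℝ) (n + 1)) :=
    ((φ.continuous_arcFrom _ _).comp (by fun_prop)).continuousOn
  refine this.congr fun t ht => ?_
  simp only
  rw [← φ.walkCurve_add hl n ⟨by linarith [ht.1], by linarith [ht.2]⟩]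
  congr 1
  ring

lemma walkCurve_periodic {k : ℕ} (hv : ∀ i j, v i = v j ↔ (k : ℤ) ∣ j - i)
    (he : ∀ i j, e i = e j ↔ (k : ℤ) ∣ j - i) : Function.Periodic (φ.walkCurve v e) k := by
  intro t
  have h1 : v (⌊t⌋ + k) = v ⌊t⌋ := (hv _ _).2 ⟨-1, by ring⟩
  have h2 : e (⌊t⌋ + k) = e ⌊t⌋ := (he _ _).2 ⟨-1, by ring⟩
  simp only [walkCurve, Int.floor_add_natCast, Int.fract_add_natCast, h1, h2]

/-- Integer parameters give vertices, the others interior points of edges. The drawing keeps the two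
kinds apart, and an interior point determines its edge and its position on it. -/
lemma walkCurve_injective {k : ℕ} (hl : ∀ i, G.IsLink (e i) (v i) (v (i + 1)))
    (hv : ∀ i j, v i = v j ↔ (k : ℤ) ∣ j - i) (he : ∀ i j, e i = e j ↔ (k : ℤ) ∣ j - i) (s t : ℝ)
    (h : φ.walkCurve v e s = φ.walkCurve v e t) : ∃ m : ℤ, t = s + m * k := by
  have key : (k : ℤ) ∣ ⌊t⌋ - ⌊s⌋ ∧ Int.fract s = Int.fract t := by
    unfold walkCurve at h
    have hs0 := Int.fract_nonneg s
    have ht0 := Int.fract_nonneg t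
    have hs1 := Int.fract_lt_one s
    have ht1 := Int.fract_lt_one t
    rcases hs0.eq_or_lt with hs | hs <;> rcases ht0.eq_or_lt with ht | ht
    · rw [← hs, ← ht, φ.arcFrom_zero (hl _), φ.arcFrom_zero (hl _)] at h
      exact ⟨(hv _ _).1 (φ.point_injOn (hl _).left_mem (hl _).left_mem h), hs.symm.trans ht⟩
    · rw [← hs, φ.arcFrom_zero (hl _)] at h
      exact absurd h.symm (φ.arcFrom_ne_point (hl _).edge_mem (hl _).left_mem ht ht1)
    · rw [← ht, φ.arcFrom_zero (hl _)] at h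
      exact absurd h (φ.arcFrom_ne_point (hl _).edge_mem (hl _).left_mem hs hs1)
    · by_cases hee : e ⌊s⌋ = e ⌊t⌋
      · have hdvd := (he _ _).1 hee
        refine ⟨hdvd, ?_⟩
        rw [hee, (hv _ _).2 hdvd] at h
        exact φ.injOn_arcFrom (hl _).edge_mem _ ⟨hs0, hs1.le⟩ ⟨ht0, ht1.le⟩ h
      · obtain ⟨s', hs', hs''⟩ := φ.exists_arcFrom_eq (e ⌊s⌋) (v ⌊s⌋) (Int.fract s)
        obtain ⟨t', ht', -⟩ := φ.exists_arcFrom_eq (e ⌊t⌋) (v ⌊t⌋) (Int.fract t)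
        rw [hs', ht'] at h
        exact absurd h (φ.arc_ne_arc _ (hl _).edge_mem _ (hl _).edge_mem hee _
          (hs'' hs hs1).1 (hs'' hs hs1).2 _)
  obtain ⟨⟨m, hm⟩, hfr⟩ := key
  refine ⟨m, ?_⟩
  have h1 := Int.floor_add_fract s
  have h2 := Int.floor_add_fract t
  have h3 : (⌊t⌋ : ℝ) - ⌊s⌋ = k * m := by exact_mod_cast hm
  linarith

lemma range_walkCurve [G.Loopless] (hl : ∀ i, G.IsLink (e i) (v i) (v (i + 1))) :
    range (φ.walkCurve v e) = φ.trace (range e) := by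
  ext z
  simp only [trace, mem_range, iUnion_exists, iUnion_iUnion_eq', mem_iUnion]
  constructor
  · rintro ⟨t, rfl⟩
    obtain ⟨s, hs, -⟩ := φ.exists_arcFrom_eq (e ⌊t⌋) (v ⌊t⌋) (Int.fract t)
    exact ⟨⌊t⌋, s, hs.symm⟩
  · rintro ⟨i, s, rfl⟩
    obtain ⟨t, ht, h⟩ := φ.exists_arcFrom_eq_arc (e i) (v i) s
    exact ⟨i + t, by rw [φ.walkCurve_add hl i ht, h]⟩

lemma point_mem_range_walkCurve [G.Loopless] (hl : ∀ i, G.IsLink (e i) (v i) (v (i + 1))) {w : α}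
    (hw : w ∈ G.vertexSet) : φ.point w ∈ range (φ.walkCurve v e) ↔ w ∈ range v := by
  constructor
  · rintro ⟨t, ht⟩
    rcases φ.arcFrom_eq_point (hl ⌊t⌋) hw ⟨Int.fract_nonneg t, (Int.fract_lt_one t).le⟩ ht with h | h
    · exact ⟨_, h.symm⟩
    · exact ⟨_, h.symm⟩
  · rintro ⟨i, rfl⟩
    exact ⟨i, φ.walkCurve_intCast hl i⟩

end Walk

end PlaneDrawing

end Graph

/-! ### Edge weights and their product around a cycle. -/

lemma prod_range_alternating {s : ℕ → ℂ} (hs : ∀ i, s (i + 1) = - s i) (h0 : s 0 * s 0 = 1)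
    (m : ℕ) : ∏ i ∈ Finset.range (2 * m), s i = (-1) ^ m := by
  have hsq : ∀ i, s i * s i = 1 := fun i => by
    induction i with
    | zero => exact h0
    | succ i ih => rw [hs, neg_mul_neg, ih]
  induction m with
  | zero => simp
  | succ m ih =>
    rw [show 2 * (m + 1) = 2 * m + 1 + 1 by ring, Finset.prod_range_succ, Finset.prod_range_succ,
      ih, hs, mul_assoc, mul_neg, hsq, pow_succ]

lemma exp_int_mul_pi_mul_I_of_odd {n : ℤ} (hn : Odd n) : exp (n * (Real.pi * I)) = -1 := by
  rw [Complex.exp_int_mul, Complex.exp_pi_mul_I, hn.neg_one_zpow]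

lemma exp_int_mul_pi_mul_I_of_not_odd {n : ℤ} (hn : ¬ Odd n) : exp (n * (Real.pi * I)) = 1 := by
  rw [Complex.exp_int_mul, Complex.exp_pi_mul_I, (Int.not_odd_iff_even.1 hn).neg_one_zpow]

namespace Graph

variable {α : Type u} {β : Type v} {G : Graph α β}

namespace PlaneDrawing

variable (φ : G.PlaneDrawing) (V : Finset α)

open Classical in
/-- The total variation of `log` along the edge `e` from `x` to `y`, as seen from all other
vertices. -/
noncomputable def edgeLog (e : β) (x y : α) : ℂ :=
  ∑ w ∈ V, if w = x ∨ w = y then 0 else logVar fun t => φ.arcFrom e x t - φ.point w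

open Classical in
/-- The product of the differences between the point of `x` and those of all other vertices. -/
noncomputable def vertexProd (x : α) : ℂ := ∏ w ∈ V.erase x, (φ.point x - φ.point w)

/-- A square root of `vertexProd`. -/
noncomputable def vertexRoot (x : α) : ℂ := exp (log (φ.vertexProd V x) / 2)

/-- The weight of the edge `e` traversed from `x` to `y`; it is `I` or `-I`. -/
noncomputable def edgeWeight (e : β) (x y : α) : ℂ :=
  exp (φ.edgeLog V e x y / 2) * (φ.vertexRoot V x / φ.vertexRoot V y)

variable {V} {e : β} {x y : α}

lemma edgeLog_symm [G.Loopless] (hV : ∀ w, w ∈ V ↔ w ∈ G.vertexSet) (h : G.IsLink e x y) :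
    φ.edgeLog V e y x = - φ.edgeLog V e x y := by
  classical
  unfold edgeLog
  rw [← Finset.sum_neg_distrib]
  refine Finset.sum_congr rfl fun w hw => ?_
  by_cases hc : w = x ∨ w = y
  · rw [if_pos hc, if_pos hc.symm, neg_zero]
  · rw [if_neg hc, if_neg fun h => hc h.symm]
    push Not at hc
    have := logVar_reverse (f := fun t => φ.arcFrom e x t - φ.point w)
      ((φ.continuous_arcFrom e x).sub continuous_const) fun t =>
        sub_ne_zero.2 (φ.arcFrom_ne_point' h ((hV w).1 hw) hc.1 hc.2 t)
    rw [← this]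
    simp only [φ.arcFrom_symm h]

lemma vertexProd_ne_zero (hV : ∀ w, w ∈ V ↔ w ∈ G.vertexSet) (hx : x ∈ G.vertexSet) :
    φ.vertexProd V x ≠ 0 := by
  classical
  unfold vertexProd
  refine Finset.prod_ne_zero_iff.2 fun w hw => sub_ne_zero.2 fun h => ?_
  rw [Finset.mem_erase] at hw
  exact hw.1 (φ.point_injOn hx ((hV w).1 hw.2) h).symm

lemma vertexRoot_ne_zero : φ.vertexRoot V x ≠ 0 := exp_ne_zero _

lemma vertexRoot_sq (hV : ∀ w, w ∈ V ↔ w ∈ G.vertexSet) (hx : x ∈ G.vertexSet) :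
    φ.vertexRoot V x ^ 2 = φ.vertexProd V x := by
  rw [vertexRoot, ← Complex.exp_nat_mul, Nat.cast_ofNat, mul_div_cancel₀ _ two_ne_zero,
    Complex.exp_log (φ.vertexProd_ne_zero hV hx)]

/-- The factors `w ≠ x, y` give `∏ (y - w) / (x - w)`; completing it to `P y / P x` introduces `(y -
x) / (x - y) = -1`, the source of the minus sign. -/
lemma exp_edgeLog [G.Loopless] (hV : ∀ w, w ∈ V ↔ w ∈ G.vertexSet) (h : G.IsLink e x y) :
    exp (φ.edgeLog V e x y) = - (φ.vertexProd V y / φ.vertexProd V x) := by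
  classical
  have hx : x ∈ V := (hV x).2 h.left_mem
  have hy : y ∈ V := (hV y).2 h.right_mem
  have hne : x ≠ y := h.ne
  have hsplit : ∀ f : α → ℂ, ∏ w ∈ V, (if w = x ∨ w = y then 1 else f w) =
      ∏ w ∈ (V.erase x).erase y, f w := by
    intro f
    rw [← Finset.mul_prod_erase V _ hx, ← Finset.mul_prod_erase (V.erase x) _
      (Finset.mem_erase.2 ⟨hne.symm, hy⟩)]
    simp only [true_or, or_true, if_true, one_mul]
    refine Finset.prod_congr rfl fun w hw => ?_
    simp only [Finset.mem_erase] at hw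
    rw [if_neg (by tauto)]
  have h1 : exp (φ.edgeLog V e x y) = ∏ w ∈ (V.erase x).erase y,
      ((φ.point y - φ.point w) / (φ.point x - φ.point w)) := by
    rw [edgeLog, Complex.exp_sum, ← hsplit]
    refine Finset.prod_congr rfl fun w hw => ?_
    split_ifs with hc
    · exact exp_zero
    · push Not at hc
      rw [exp_logVar (f := fun t => φ.arcFrom e x t - φ.point w) ((φ.continuous_arcFrom e x).sub continuous_const) fun t =>
        sub_ne_zero.2 (φ.arcFrom_ne_point' h ((hV w).1 hw) hc.1 hc.2 t),
        φ.arcFrom_zero h, φ.arcFrom_one h]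
  have hxy : φ.point x - φ.point y ≠ 0 := sub_ne_zero.2 (φ.point_ne h)
  have hpx : φ.vertexProd V x = (φ.point x - φ.point y) *
      ∏ w ∈ (V.erase x).erase y, (φ.point x - φ.point w) :=
    (Finset.mul_prod_erase _ _ (Finset.mem_erase.2 ⟨hne.symm, hy⟩)).symm
  have hpy : φ.vertexProd V y = (φ.point y - φ.point x) *
      ∏ w ∈ (V.erase x).erase y, (φ.point y - φ.point w) := by
    rw [Finset.erase_right_comm]
    exact (Finset.mul_prod_erase _ _ (Finset.mem_erase.2 ⟨hne, hx⟩)).symm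
  have hx0 := φ.vertexProd_ne_zero hV h.left_mem
  rw [hpx] at hx0
  have hx0' := right_ne_zero_of_mul hx0
  rw [h1, Finset.prod_div_distrib, hpx, hpy]
  field_simp
  ring

lemma edgeWeight_mul_self [G.Loopless] (hV : ∀ w, w ∈ V ↔ w ∈ G.vertexSet) (h : G.IsLink e x y) :
    φ.edgeWeight V e x y * φ.edgeWeight V e x y = -1 := by
  have h1 : exp (φ.edgeLog V e x y / 2) * exp (φ.edgeLog V e x y / 2) =
      - (φ.vertexProd V y / φ.vertexProd V x) := by
    rw [← Complex.exp_add, add_halves, φ.exp_edgeLog hV h]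
  rw [← φ.vertexRoot_sq hV h.left_mem, ← φ.vertexRoot_sq hV h.right_mem] at h1
  have hx := φ.vertexRoot_ne_zero (V := V) (x := x)
  have hy := φ.vertexRoot_ne_zero (V := V) (x := y)
  rw [edgeWeight, mul_mul_mul_comm, h1]
  field_simp

/-- The weights of the two directions are mutually inverse, and the inverse of a square root of `-1`
is its negative. -/
lemma edgeWeight_symm [G.Loopless] (hV : ∀ w, w ∈ V ↔ w ∈ G.vertexSet) (h : G.IsLink e x y) :
    φ.edgeWeight V e y x = - φ.edgeWeight V e x y := by
  have hmul : φ.edgeWeight V e y x * φ.edgeWeight V e x y = 1 := by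
    have hx := φ.vertexRoot_ne_zero (V := V) (x := x)
    have hy := φ.vertexRoot_ne_zero (V := V) (x := y)
    rw [edgeWeight, edgeWeight, mul_mul_mul_comm, φ.edgeLog_symm hV h, ← Complex.exp_add]
    rw [show -φ.edgeLog V e x y / 2 + φ.edgeLog V e x y / 2 = 0 by ring, exp_zero]
    field_simp
  have hself := φ.edgeWeight_mul_self hV h
  linear_combination φ.edgeWeight V e y x * hself - φ.edgeWeight V e x y * hmul

lemma prod_edgeWeight_eq {v : ℤ → α} {e : ℤ → β} {k : ℕ} (hvk : v k = v 0) :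
    ∏ i ∈ Finset.range k, φ.edgeWeight V (e i) (v i) (v (i + 1)) =
      exp ((∑ i ∈ Finset.range k, φ.edgeLog V (e i) (v i) (v (i + 1))) / 2) := by
  unfold edgeWeight
  rw [Finset.prod_mul_distrib, Finset.sum_div, Complex.exp_sum]
  have hdiv : ∀ n : ℕ, ∏ i ∈ Finset.range n, φ.vertexRoot V (v i) / φ.vertexRoot V (v (i + 1)) =
      φ.vertexRoot V (v 0) / φ.vertexRoot V (v n) := fun n => by
    induction n with
    | zero => simp [div_self φ.vertexRoot_ne_zero]
    | succ n ih =>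
      have := φ.vertexRoot_ne_zero (V := V) (x := v n)
      rw [Finset.prod_range_succ, ih]
      push_cast
      field_simp
  have : ∏ i ∈ Finset.range k, φ.vertexRoot V (v i) / φ.vertexRoot V (v (i + 1)) = 1 := by
    rw [hdiv, hvk, div_self φ.vertexRoot_ne_zero]
  rw [this, mul_one]

open Classical in
/-- The total of `edgeLog` around a cycle of even length is determined, modulo `4πi`, by the number
of enclosed vertices. -/
lemma exp_sum_edgeLog [G.Loopless] (hV : ∀ w, w ∈ V ↔ w ∈ G.vertexSet) {v : ℤ → α} {e : ℤ → β}
    {m : ℕ} (hm : 0 < m) (hl : ∀ i, G.IsLink (e i) (v i) (v (i + 1)))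
    (hv : ∀ i j, v i = v j ↔ ((2 * m : ℕ) : ℤ) ∣ j - i)
    (he : ∀ i j, e i = e j ↔ ((2 * m : ℕ) : ℤ) ∣ j - i) :
    exp ((∑ i ∈ Finset.range (2 * m), φ.edgeLog V (e i) (v i) (v (i + 1))) / 2) =
      (-1) ^ φ.chi (range e) * (-1) ^ (m - 1) := by
  set d := φ.walkCurve v e with hd
  have hcont : Continuous d := φ.continuous_walkCurve hl
  have hper : Function.Periodic d ((2 * m : ℕ) : ℝ) := φ.walkCurve_periodic hv he
  have hinj : ∀ s t, d s = d t → ∃ j : ℤ, t = s + j * ((2 * m : ℕ) : ℝ) :=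
    φ.walkCurve_injective hl hv he
  have hrange : range d = φ.trace (range e) := φ.range_walkCurve hl
  have hdi : ∀ i : ℕ, d i = φ.point (v i) := fun i => by
    have := φ.walkCurve_intCast hl i
    rwa [Int.cast_natCast] at this
  have hVv : ∀ i, v i ∈ V := fun i => (hV _).2 (hl i).left_mem
  have hlog : ∀ (i : ℕ) (w : α), logVar (fun t => φ.arcFrom (e i) (v i) t - φ.point w) =
      logVar (fun t => d (i + t) - φ.point w) := fun i w =>
    logVar_congr fun t ht => by
      have := φ.walkCurve_add hl i ht
      rw [Int.cast_natCast] at this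
      rw [hd, this]
  -- the vertices on the cycle
  set A : Finset α := (Finset.range (2 * m)).image fun i : ℕ => v i with hA
  have hAmem : ∀ w, w ∈ A ↔ w ∈ range v := by
    intro w
    simp only [hA, Finset.mem_image, Finset.mem_range, mem_range]
    constructor
    · rintro ⟨i, -, rfl⟩; exact ⟨_, rfl⟩
    · rintro ⟨i, rfl⟩
      have hpos : (0 : ℤ) < (2 * m : ℕ) := by exact_mod_cast (by omega : 0 < 2 * m)
      have h0 := Int.emod_nonneg i hpos.ne'
      have h1 := Int.emod_lt_of_pos i hpos
      refine ⟨(i % (2 * m : ℕ)).toNat, by omega, ?_⟩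
      rw [Int.toNat_of_nonneg h0, hv]
      exact Int.dvd_self_sub_emod
  have hAV : A ⊆ V := fun w hw => by
    obtain ⟨i, rfl⟩ := (hAmem w).1 hw
    exact hVv i
  have hpt : ∀ a ∈ V, ∀ b ∈ V, (φ.point a = φ.point b ↔ a = b) := fun a ha b hb =>
    φ.point_injOn.eq_iff ((hV a).1 ha) ((hV b).1 hb)
  let T : α → ℂ := fun w => ∑ i ∈ Finset.range (2 * m),
    if w = v i ∨ w = v (i + 1) then 0 else logVar fun t => φ.arcFrom (e i) (v i) t - φ.point w
  -- Summing by viewpoint instead of by edge separates vertices off the cycle from those on it.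
  have hswap : ∑ i ∈ Finset.range (2 * m), φ.edgeLog V (e i) (v i) (v (i + 1)) =
      ∑ w ∈ V \ A, T w + ∑ w ∈ A, T w := by
    rw [Finset.sum_sdiff hAV]
    exact Finset.sum_comm
  obtain ⟨k, ⟨c, rfl⟩, hk⟩ := exists_sum_sum_logVar hcont hper (by omega) hinj
  have hon : ∑ w ∈ A, T w =
      (((2 * m : ℕ) : ℂ) - 2) * (((2 * c + 1 : ℤ) : ℂ) * (Real.pi * I)) := by
    rw [← hk, hA, Finset.sum_image]
    · refine Finset.sum_congr rfl fun j _ => Finset.sum_congr rfl fun i _ => ?_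
      rw [hlog]
      refine if_congr ?_ rfl (by rw [hdi])
      rw [hdi, hdi, hdi, hpt _ (hVv _) _ (hVv _), hpt _ (hVv _) _ (hVv _), Nat.cast_add,
        Nat.cast_one]
    · intro i hi j hj hij
      have := (hv _ _).1 hij
      simp only [Finset.coe_range, mem_Iio] at hi hj
      have := Int.eq_zero_of_abs_lt_dvd this (by rw [abs_lt]; constructor <;> push_cast <;> omega)
      omega
  have hoff : ∀ w ∈ V \ A, exp (T w / 2) = if φ.Encloses (range e) (φ.point w) then -1 else 1 := by
    intro w hw
    rw [Finset.mem_sdiff] at hw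
    have hwv : w ∉ range v := fun h => hw.2 ((hAmem w).2 h)
    have hwd : φ.point w ∉ range d := fun h =>
      hwv ((φ.point_mem_range_walkCurve hl ((hV w).1 hw.1)).1 h)
    obtain ⟨n, hn, hodd⟩ := exists_sum_logVar_of_notMem hcont hper (by omega) hinj hwd
    have hT : T w = n * (2 * Real.pi * I) := by
      rw [← hn]
      refine Finset.sum_congr rfl fun i _ => ?_
      rw [if_neg, hlog]
      rintro (h | h)
      · exact hwv ⟨_, h.symm⟩
      · exact hwv ⟨_, h.symm⟩
    have henc : φ.Encloses (range e) (φ.point w) ↔ Odd n := by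
      rw [← hodd, Encloses, ← hrange]
      exact and_iff_right hwd
    -- Halving the variation leaves exactly the parity of the winding number.
    rw [hT, show (n : ℂ) * (2 * Real.pi * I) / 2 = n * (Real.pi * I) by ring]
    split_ifs with hc
    · exact exp_int_mul_pi_mul_I_of_odd (henc.1 hc)
    · exact exp_int_mul_pi_mul_I_of_not_odd fun h => hc (henc.2 h)
  have hchi : φ.chi (range e) = ((V \ A).filter fun w => φ.Encloses (range e) (φ.point w)).card := by
    rw [chi, ← Set.ncard_coe_finset]
    congr 1
    ext w
    simp only [mem_ofPred_eq, Finset.coe_filter, Finset.mem_sdiff, hV]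
    refine ⟨fun h => ⟨⟨h.1, fun hA' => h.2.1 ?_⟩, h.2⟩, fun h => ⟨h.1.1, h.2⟩⟩
    rw [← hrange, φ.point_mem_range_walkCurve hl h.1]
    exact (hAmem w).1 hA'
  rw [hswap, add_div, Complex.exp_add, Finset.sum_div, Complex.exp_sum,
    Finset.prod_congr rfl hoff, Finset.prod_ite, hon]
  simp only [Finset.prod_const, one_pow, mul_one, ← hchi]
  congr 1
  obtain ⟨q, rfl⟩ := Nat.exists_eq_add_of_le' hm
  rw [show (((2 * (q + 1) : ℕ) : ℂ) - 2) * (((2 * c + 1 : ℤ) : ℂ) * (Real.pi * I)) / 2 =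
    (q : ℂ) * (((2 * c + 1 : ℤ) : ℂ) * (Real.pi * I)) by push_cast; ring, Complex.exp_nat_mul,
    exp_int_mul_pi_mul_I_of_odd ⟨c, rfl⟩, Nat.add_sub_cancel]

/-! ### From edge weights to the sign. -/

/-- In a bipartite plane multigraph there are edge weights whose product over each cycle is the
sign of the cycle. -/
lemma exists_edge_weights [G.Loopless] (hVfin : G.vertexSet.Finite) (hbip : G.IsBipartite) :
    ∃ κ : β → ℂ, ∀ C, G.IsCycleSet C → ∏ᶠ e ∈ C, κ e = (-1) ^ (φ.chi C + 1) := by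
  classical
  obtain ⟨X, Y, hXY, -, hlink⟩ := hbip
  set V := hVfin.toFinset
  have hV : ∀ w, w ∈ V ↔ w ∈ G.vertexSet := fun w => hVfin.mem_toFinset
  choose a haX b hbY hab using hlink
  have hcross : ∀ {e x y}, G.IsLink e x y → (y ∈ X ↔ x ∉ X) := by
    intro e x y h
    have hE := h.edge_mem
    have h1 := haX e hE
    have h2 : b e hE ∉ X := fun h' => Set.disjoint_left.1 hXY h' (hbY e hE)
    rcases h.eq_and_eq_or_eq_and_eq (hab e hE) with ⟨hx, hy⟩ | ⟨hx, hy⟩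
    · rw [hx, hy]; tauto
    · rw [hx, hy]; tauto
  -- Bipartiteness orients every edge from `X` to `Y`; `σ` records whether a traversal follows that
  -- orientation.
  let κ : β → ℂ := fun e => if h : e ∈ G.edgeSet then φ.edgeWeight V e (a e h) (b e h) else 1
  let σ : α → ℂ := fun x => if x ∈ X then 1 else -1
  have hσκ : ∀ {e x y}, G.IsLink e x y → φ.edgeWeight V e x y = σ x * κ e := by
    intro e x y h
    have hE := h.edge_mem
    have h1 := haX e hE
    have h2 : b e hE ∉ X := fun h' => Set.disjoint_left.1 hXY h' (hbY e hE)
    simp only [κ, σ, dif_pos hE]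
    rcases h.eq_and_eq_or_eq_and_eq (hab e hE) with ⟨hx, hy⟩ | ⟨hx, hy⟩
    · rw [hx, hy, if_pos h1, one_mul]
    · rw [hx, hy, if_neg h2, neg_one_mul, φ.edgeWeight_symm hV (hab e hE)]
  refine ⟨κ, fun C hC => ?_⟩
  obtain ⟨k, v, e, hk, hl, hv, he, rfl⟩ := hC.exists_periodic
  have hσ : ∀ i : ℤ, σ (v (i + 1)) = - σ (v i) := fun i => by
    have := hcross (hl i)
    simp only [σ]
    by_cases hi : v i ∈ X
    · rw [if_pos hi, if_neg (by tauto)]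
    · rw [if_neg hi, if_pos (by tauto), neg_neg]
  have hσσ : ∀ x, σ x * σ x = 1 := fun x => by simp only [σ]; split_ifs <;> norm_num
  have hvk : v k = v 0 := (hv _ _).2 ⟨-1, by ring⟩
  -- `σ` alternates along the cycle and returns to its initial value.
  obtain ⟨m, rfl⟩ : ∃ m, k = 2 * m := by
    have hpow : ∀ i : ℕ, σ (v i) = (-1) ^ i * σ (v 0) := fun i => by
      induction i with
      | zero => simp
      | succ i ih => push_cast; rw [hσ, ih]; ring
    have h1 := hpow k
    rw [hvk] at h1
    have h2 : (-1 : ℂ) ^ k = 1 := by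
      have := congrArg (· * σ (v 0)) h1
      simp only [mul_assoc, hσσ, mul_one] at this
      exact this.symm
    by_contra hodd
    rw [Odd.neg_one_pow (Nat.not_even_iff_odd.1 fun h => hodd h.two_dvd)] at h2
    norm_num at h2
  have hm : 0 < m := by omega
  have hprod : ∏ᶠ f ∈ range e, κ f = ∏ i ∈ Finset.range (2 * m), κ (e i) := by
    have himg : range e = (fun i : ℕ => e i) '' ↑(Finset.range (2 * m)) := by
      ext x
      constructor
      · rintro ⟨i, rfl⟩
        have hpos : (0 : ℤ) < (2 * m : ℕ) := by exact_mod_cast hk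
        have h0 := Int.emod_nonneg i hpos.ne'
        have h1 := Int.emod_lt_of_pos i hpos
        refine ⟨(i % (2 * m : ℕ)).toNat, by simp only [Finset.coe_range, mem_Iio]; omega, ?_⟩
        simp only
        rw [Int.toNat_of_nonneg h0, he]
        exact Int.dvd_self_sub_emod
      · rintro ⟨i, -, rfl⟩
        exact ⟨_, rfl⟩
    rw [himg, finprod_mem_image, finprod_mem_coe_finset]
    intro i hi j hj hij
    have := (he _ _).1 hij
    simp only [Finset.coe_range, mem_Iio] at hi hj
    have := Int.eq_zero_of_abs_lt_dvd this (by rw [abs_lt]; constructor <;> push_cast <;> omega)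
    omega
  have h1 := φ.exp_sum_edgeLog hV hm hl hv he
  rw [← φ.prod_edgeWeight_eq hvk, Finset.prod_congr rfl fun (i : ℕ) _ => hσκ (hl i),
    Finset.prod_mul_distrib, prod_range_alternating (s := fun i : ℕ => σ (v i))
      (fun i => by simpa using hσ i) (hσσ _) m, ← hprod] at h1
  obtain ⟨q, rfl⟩ := Nat.exists_eq_add_of_le' hm
  have hq : ((-1 : ℂ) ^ q) * (-1) ^ q = 1 := by rw [← mul_pow]; simp
  rw [Nat.add_sub_cancel, pow_succ] at h1
  rw [pow_succ]
  linear_combination (-(-1 : ℂ) ^ q) * h1 +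
    (-(-1 : ℂ) ^ φ.chi (range e) - ∏ᶠ f ∈ range e, κ f) * hq

lemma sign_eq_finprod {κ : β → ℂ} (hE : G.edgeSet.Finite)
    (hκ : ∀ C, G.IsCycleSet C → ∏ᶠ e ∈ C, κ e = (-1) ^ (φ.chi C + 1)) {D : Finset (Set β)}
    (hD : G.IsCycleDecomposition D) : (φ.sign D : ℂ) = ∏ᶠ e ∈ G.edgeSet, κ e := by
  have hfin : ∀ C ∈ D, C.Finite := fun C hC => hE.subset <| by
    rw [← hD.cover]
    exact subset_biUnion_of_mem (u := fun C => C) hC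
  have := finprod_mem_biUnion (f := κ) (t := fun C : Set β => C) (I := (D : Set (Set β)))
    (fun C hC C' hC' h => hD.disjoint C hC C' hC' h) D.finite_toSet hfin
  have hcov : ⋃ C ∈ (D : Set (Set β)), C = G.edgeSet := hD.cover
  rw [hcov, finprod_mem_coe_finset] at this
  rw [this, sign]
  push_cast
  exact Finset.prod_congr rfl fun C hC => (hκ C (hD.isCycleSet C hC)).symm

end PlaneDrawing

end Graph

end

/-- All cycle decompositions of a connected bipartite even plane multigraph have the same sign. -/
theorem mainTheorem3 {α : Type u} {β : Type v} (G : Graph α β)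
    (hV : G.vertexSet.Finite) (hE : G.edgeSet.Finite) (hloop : G.Loopless)
    (hconn : G.IsConnected) (hbip : G.IsBipartite) (heven : G.IsEven)
    (φ : G.PlaneDrawing) (D D' : Finset (Set β))
    (hD : G.IsCycleDecomposition D) (hD' : G.IsCycleDecomposition D') :
    φ.sign D = φ.sign D' := by
  obtain ⟨κ, hκ⟩ := φ.exists_edge_weights hV hbip
  exact Int.cast_injective (α := ℂ)
    ((φ.sign_eq_finprod hE hκ hD).trans (φ.sign_eq_finprod hE hκ hD').symm)
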